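/- Let $n\ge 1$ and let $\mathbf L,\mathbf C,\mathbf R,\mathbf G\in\mathbb R^{n\times n}$ be symmetric, with $\mathbf L$ and $\mathbf C$ positive definite. Write $\|\cdot\|$ for the spectral norm (induced by the Euclidean norm), $\mathbb R^+=(0,\infty)$, $\mathbb C^+_\alpha=\{s\in\mathbb C:\operatorname{Re}s>\alpha\}$, and $\lambda_{\min},\lambda_{\max}$ for the smallest and largest eigenvalue of a symmetric matrix. Put $$\alpha=-\min\Big\{\tfrac{\lambda_{\min}(\mathbf G)}{\lambda_{\max}(\mathbf C)},\tfrac{\lambda_{\min}(\mathbf G)}{\lambda_{\min}(\mathbf C)},\tfrac{\lambda_{\min}(\mathbf R)}{\lambda_{\max}(\mathbf L)},\tfrac{\lambda_{\min}(\mathbf R)}{\lambda_{\min}(\mathbf L)}\Big\},\qquad \kappa=\sup_{\omega\in\mathbb R}\left\|\exp\begin{bmatrix}0&i\omega\mathbf L\\ i\omega\mathbf C&0\end{bmatrix}\right\|,$$ $$\theta=\frac{\max\{\|\mathbf R\|,\|\mathbf G\|\}}{\max\{\|\mathbf L\|,\|\mathbf C\|\}},\qquad \nu=\frac{1}{\kappa\max\{\|\mathbf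 L\|,\|\mathbf C\|\}};$$ here $\kappa<\infty$. For every $s\in\mathbb C^+_\alpha$ there is exactly one matrix $Q(s)\in\mathbb C^{n\times n}$ with $Q(s)^2=(\mathbf Cs+\mathbf G)(\mathbf Ls+\mathbf R)$ whose eigenvalues all have positive real part. For $d\in\mathbb R^+$ set $$B_d(s)=(\mathbf Ls+\mathbf R)\,Q(s)^{-1}\sinh\big(d\,Q(s)\big),\qquad D_d(s)=\cosh\big(d\,Q(s)\big).$$ Then $B_d(s)$ is invertible for all $s\in\mathbb C^+_\alpha$ and $d\in\mathbb R^+$, so that the admittance matrix $$Y(s,d)=\begin{bmatrix}D_d(s)B_d(s)^{-1}&-B_d(s)^{-1}\\-B_d(s)^{-1}&D_d(s)B_d(s)^{-1}\end{bmatrix}\in\mathbb C^{2n\times 2n}$$ is well defined on $\mathbb C^+_\alpha\times\mathbb R^+$, and: 1. $Y$ is continuous on $\mathbb C^+_\alpha\times\mathbb R^+$. 2. For every $d\in\mathbb R^+$ the map $s\mapsto Y(s,d)$ is analytic on $\mathbb C^+_\alpha$. 3. For every $\beta\ge0$ with $\beta>\alpha$ and every $\delta>0$ there is $M>0$ such that,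 for all $s\in\mathbb C$ with $\operatorname{Re}s\ge\beta$ and all $d\ge\delta$, $$\|Y(s,d)\|\le M\,e^{\frac{nd}{\nu}\operatorname{Re}(s+\theta)}.$$ -/

import Mathlib

-- The norm on matrices is the spectral norm (induced by the Euclidean norm).
open scoped Matrix.Norms.L2Operator

noncomputable section

namespace TransmissionLine

/-- A real matrix regarded as a complex matrix. -/
def toC {m n : Type*} (A : Matrix m n ℝ) : Matrix m n ℂ := A.map Complex.ofReal

/-- Smallest real eigenvalue of a real matrix; for a symmetric matrix all eigenvalues are real. -/
def lamMin {n : ℕ} (A : Matrix (Fin n) (Fin n) ℝ) : ℝ := sInf (spectrum ℝ A)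

/-- Largest real eigenvalue of a real matrix; for a symmetric matrix all eigenvalues are real. -/
def lamMax {n : ℕ} (A : Matrix (Fin n) (Fin n) ℝ) : ℝ := sSup (spectrum ℝ A)

/-- `X` is a principal square root of `A`: its spectrum lies in the open right half-plane and
its square is `A`. -/
def IsPrincipalSqrt {n : ℕ} (A X : Matrix (Fin n) (Fin n) ℂ) : Prop :=
  (∀ z ∈ spectrum ℂ X, 0 < z.re) ∧ X ^ 2 = A

open Classical in
/-- The principal square root of `A`, where it exists and is unique (the value `0` otherwise
is a placeholder). -/
def principalSqrt {n : ℕ} (A : Matrix (Fin n) (Fin n) ℂ) : Matrix (Fin n) (Fin n) ℂ :=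
  if h : ∃! X, IsPrincipalSqrt A X then h.choose else 0

/-- Matrix hyperbolic cosine. -/
def mcosh {n : ℕ} (X : Matrix (Fin n) (Fin n) ℂ) : Matrix (Fin n) (Fin n) ℂ :=
  (1 / 2 : ℂ) • (NormedSpace.exp X + NormedSpace.exp (-X))

/-- Matrix hyperbolic sine. -/
def msinh {n : ℕ} (X : Matrix (Fin n) (Fin n) ℂ) : Matrix (Fin n) (Fin n) ℂ :=
  (1 / 2 : ℂ) • (NormedSpace.exp X - NormedSpace.exp (-X))

/-- The affine matrix function `A s + B`, for real `A`, `B`; thus `L s + R` is the series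
impedance and `C s + G` the shunt admittance per unit length. -/
def pencil {n : ℕ} (A B : Matrix (Fin n) (Fin n) ℝ) (s : ℂ) : Matrix (Fin n) (Fin n) ℂ :=
  s • toC A + toC B

/-- The abscissa of the half-plane. -/
def alpha {n : ℕ} (L C R G : Matrix (Fin n) (Fin n) ℝ) : ℝ :=
  -(min (min (lamMin G / lamMax C) (lamMin G / lamMin C))
        (min (lamMin R / lamMax L) (lamMin R / lamMin L)))

/-- `√((C s + G)(L s + R))`, the principal square root. -/
def rootCL {n : ℕ} (L C R G : Matrix (Fin n) (Fin n) ℝ) (s : ℂ) : Matrix (Fin n) (Fin n) ℂ :=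
  principalSqrt (pencil C G s * pencil L R s)

/-- `Z(s) = (L s + R) √((C s + G)(L s + R))⁻¹`. -/
def Zc {n : ℕ} (L C R G : Matrix (Fin n) (Fin n) ℝ) (s : ℂ) : Matrix (Fin n) (Fin n) ℂ :=
  pencil L R s * (rootCL L C R G s)⁻¹

/-- `B_d(s) = Z(s) sinh(d √((C s + G)(L s + R)))`. -/
def Bd {n : ℕ} (L C R G : Matrix (Fin n) (Fin n) ℝ) (d : ℝ) (s : ℂ) :
    Matrix (Fin n) (Fin n) ℂ :=
  Zc L C R G s * msinh ((d : ℂ) • rootCL L C R G s)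

/-- `D_d(s) = cosh(d √((C s + G)(L s + R)))`. -/
def Dd {n : ℕ} (L C R G : Matrix (Fin n) (Fin n) ℝ) (d : ℝ) (s : ℂ) :
    Matrix (Fin n) (Fin n) ℂ :=
  mcosh ((d : ℂ) • rootCL L C R G s)

/-- The admittance matrix `Y(s,d)` of a line of length `d`. -/
def admittance {n : ℕ} (L C R G : Matrix (Fin n) (Fin n) ℝ) (s : ℂ) (d : ℝ) :
    Matrix (Fin n ⊕ Fin n) (Fin n ⊕ Fin n) ℂ :=
  Matrix.fromBlocks
    (Dd L C R G d s * (Bd L C R G d s)⁻¹) (-(Bd L C R G d s)⁻¹)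
    (-(Bd L C R G d s)⁻¹) (Dd L C R G d s * (Bd L C R G d s)⁻¹)

/-- The norm of the exponential of the lossless line at angular frequency `ω`. -/
def losslessNorm {n : ℕ} (L C : Matrix (Fin n) (Fin n) ℝ) (ω : ℝ) : ℝ :=
  ‖NormedSpace.exp (Matrix.fromBlocks 0 ((Complex.I * (ω : ℂ)) • toC L)
      ((Complex.I * (ω : ℂ)) • toC C) 0)‖

/-- `κ`, the supremum over all frequencies of `losslessNorm`. -/
def kappa {n : ℕ} (L C : Matrix (Fin n) (Fin n) ℝ) : ℝ :=
  sSup (Set.range (losslessNorm L C))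

/-- `θ = max{‖R‖, ‖G‖} / max{‖L‖, ‖C‖}`. -/
def theta {n : ℕ} (L C R G : Matrix (Fin n) (Fin n) ℝ) : ℝ :=
  max ‖toC R‖ ‖toC G‖ / max ‖toC L‖ ‖toC C‖

/-- `ν = 1 / (κ max{‖L‖, ‖C‖})`. -/
def nu {n : ℕ} (L C : Matrix (Fin n) (Fin n) ℝ) : ℝ :=
  1 / (kappa L C * max ‖toC L‖ ‖toC C‖)

end TransmissionLine

end

namespace TransmissionLine

/-! Write `Z = L s + R` and `P = C s + G`. For `Re s > α` both have positive definite Hermitian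
part, so `P Z` has no eigenvalue in `(-∞, 0]` and has a unique principal square root `Q`. As
functions of `d`, the matrices `B_d`, `D_d` solve the telegrapher's equations `B' = Z D`, `D' = P B`
with `B_0 = 0`, `D_0 = 1`. They are therefore blocks of `exp(d M)` with `M = [[0, Z], [P, 0]]`
(`Bd_eq_toBlocks`, `Dd_eq_toBlocks`). The square root has disappeared, and continuity and
analyticity of `Y` follow once `B_d` is known to be invertible. Invertibility and the bound come
from dissipation. Put `u = B_t x`, `w = D_t x`. The power flow `Re ⟪u, w⟫` starts at `0` and has
derivative `Re ⟪u, P u⟫ + Re ⟪w, Z w⟫ > 0` for `x ≠ 0`. Comparison with the stored energy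
(`le_sub_of_weighted_energy`, `energy_le_dissipation`) gives `Re ⟪u, w⟫ ≥ μ (‖u‖² + ‖w‖²)` and `Re
⟪u, w⟫ ≥ μ ‖x‖²` at `t = d`, hence `μ ‖D_d x‖ ≤ ‖B_d x‖` and `μ ‖x‖ ≤ ‖B_d x‖`. On `Re s ≥ β`, `d ≥
δ` the constant `μ` can be chosen uniformly, so `Y` is even bounded there; the exponential factor is
at least `1`. -/

/-! ### Principal square roots of matrices. -/

open Polynomial in
/-- A matrix intertwining `X` and `Y` vanishes if the spectra of `X` and `Y` are disjoint. -/
theorem eq_zero_of_mul_eq_mul {n : Type*} [Fintype n] [DecidableEq n] {X Y H : Matrix n n ℂ}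
    (hd : ∀ z ∈ spectrum ℂ X, z ∉ spectrum ℂ Y) (h : X * H = H * Y) : H = 0 := by
  cases isEmpty_or_nonempty n
  · exact Subsingleton.elim _ _
  have key : ∀ p : ℂ[X], aeval X p * H = H * aeval Y p := by
    intro p
    induction p using Polynomial.induction_on' with
    | add p q hp hq => rw [map_add, map_add, add_mul, mul_add, hp, hq]
    | monomial k a =>
      have hk : X ^ k * H = H * Y ^ k := (SemiconjBy.pow_right (a := H) (x := Y) (y := X) h.symm k).symm
      rw [aeval_monomial, aeval_monomial, mul_assoc, hk, ← mul_assoc, ← mul_assoc,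
        Algebra.commutes a H]
  -- Cayley–Hamilton for `X`; by spectral mapping the characteristic polynomial of `X` is invertible
  -- at `Y`.
  have h0 : H * aeval Y X.charpoly = 0 := by
    rw [← key, Matrix.aeval_self_charpoly, zero_mul]
  have hu : IsUnit (aeval Y X.charpoly) := by
    rw [← spectrum.zero_notMem_iff ℂ, spectrum.map_polynomial_aeval_of_nonempty Y _
      (spectrum.nonempty_of_isAlgClosed_of_finiteDimensional ℂ Y)]
    rintro ⟨z, hz, hz0⟩
    exact hd z (Matrix.mem_spectrum_iff_isRoot_charpoly.2 hz0) hz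
  exact (hu.mul_left_eq_zero).1 h0

/-- `X - Y` intertwines `X` and `-Y`, whose spectra lie on opposite sides of the imaginary axis. -/
theorem IsPrincipalSqrt.unique {n : ℕ} {A X Y : Matrix (Fin n) (Fin n) ℂ}
    (hX : IsPrincipalSqrt A X) (hY : IsPrincipalSqrt A Y) : X = Y := by
  refine sub_eq_zero.1 (eq_zero_of_mul_eq_mul (X := X) (Y := -Y) ?_ ?_)
  · intro z hz hz'
    rw [← spectrum.neg_eq, Set.mem_neg] at hz'
    have h1 := hX.1 z hz
    have h2 := hY.1 _ hz'
    rw [Complex.neg_re] at h2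
    linarith
  · have h : X * X = Y * Y := by rw [← sq, ← sq, hX.2, hY.2]
    rw [mul_sub, sub_mul, mul_neg, mul_neg, h]
    abel

theorem exists_sq_eq_re_pos {z : ℂ} (hz : z ∈ Complex.slitPlane) :
    ∃ w : ℂ, w ^ 2 = z ∧ 0 < w.re := by
  obtain ⟨w, hw⟩ := IsAlgClosed.exists_pow_nat_eq z two_pos
  rcases lt_trichotomy w.re 0 with h | h | h
  · exact ⟨-w, by rw [neg_sq, hw], by simpa using h⟩
  · exfalso
    have h1 : z.re = -(w.im ^ 2) := by rw [← hw, sq, Complex.mul_re, h]; ring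
    have h2 : z.im = 0 := by rw [← hw, sq, Complex.mul_im, h]; ring
    rcases hz with h3 | h3
    · nlinarith [sq_nonneg w.im]
    · exact h3 h2
  · exact ⟨w, hw, h⟩

open Polynomial in
theorem Splits.dvd_pow_of_roots {K : Type*} [Field K] {p q : K[X]} (hp : p.Monic)
    (hs : p.Splits) (h : ∀ z, p.IsRoot z → q.IsRoot z) : ∃ k, p ∣ q ^ k := by
  refine ⟨p.roots.card, ?_⟩
  have h1 := hs.eq_prod_roots
  rw [hp.leadingCoeff, C_1, one_mul] at h1
  have h2 : ∀ s : Multiset K, (∀ z ∈ s, q.IsRoot z) →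
      (s.map (fun x => X - C x)).prod ∣ q ^ s.card := by
    intro s
    induction s using Multiset.induction_on with
    | empty => simp
    | cons a s ih =>
      intro hs
      rw [Multiset.map_cons, Multiset.prod_cons, Multiset.card_cons, pow_succ']
      exact mul_dvd_mul (dvd_iff_isRoot.2 (hs a (Multiset.mem_cons_self a s)))
        (ih fun z hz => hs z (Multiset.mem_cons_of_mem hz))
  rw [h1]
  convert! h2 p.roots fun z hz => h z (isRoot_of_mem_roots hz) using 3
  rw [← h1]

open Polynomial in
/-- Square roots modulo a polynomial with prescribed nonzero values at its roots. -/
theorem exists_sq_sub_X_dvd {p : ℂ[X]} (hp : p.Monic) (hp0 : ¬ p.IsRoot 0) (f : ℂ → ℂ)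
    (hf : ∀ z, p.IsRoot z → f z ^ 2 = z) :
    ∃ g : ℂ[X], p ∣ g ^ 2 - X ∧ ∀ z, p.IsRoot z → g.eval z = f z := by
  have hroots : ∀ z, z ∈ p.roots.toFinset ↔ p.IsRoot z := fun z => by
    rw [Multiset.mem_toFinset, mem_roots hp.ne_zero]
  set q : ℂ[X] := Lagrange.interpolate p.roots.toFinset id f with hq
  have hqz : ∀ z, p.IsRoot z → q.eval z = f z := fun z hz =>
    Lagrange.eval_interpolate_at_node (v := id) f Function.injective_id.injOn ((hroots z).2 hz)
  obtain ⟨k, hk⟩ := Splits.dvd_pow_of_roots (q := q ^ 2 - X) hp (IsAlgClosed.splits p)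
    fun z hz => by simp [hqz z hz, hf z hz]
  have hcop : IsCoprime q p := by
    rw [isCoprime_iff_aeval_ne_zero_of_isAlgClosed ℂ ℂ]
    intro a
    by_cases ha : p.IsRoot a
    · left
      rw [coe_aeval_eq_eval, hqz a ha]
      intro h0
      have := hf a ha
      rw [h0, zero_pow two_ne_zero] at this
      exact hp0 (this ▸ ha)
    · right
      rwa [coe_aeval_eq_eval]
  have hunit : IsUnit (AdjoinRoot.mk p q) := by
    obtain ⟨a, b, hab⟩ := hcop
    refine IsUnit.of_mul_eq_one (AdjoinRoot.mk p a) ?_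
    rw [← map_mul, ← map_one (AdjoinRoot.mk p), ← hab, map_add, map_mul _ b, AdjoinRoot.mk_self,
      mul_zero, add_zero, mul_comm]
  -- The interpolant `q` is a square root of `X` modulo nilpotents, and `2 q` is a unit modulo `p`.
  -- Newton iteration then lifts `q` to an exact root that differs from it by a nilpotent, so the
  -- values at the roots of `p` are kept.
  have hnil : IsNilpotent (aeval (AdjoinRoot.mk p q)
      (X ^ 2 - C (AdjoinRoot.mk p X) : (AdjoinRoot p)[X])) := by
    refine ⟨k, ?_⟩
    rw [map_sub, map_pow, aeval_X, aeval_C, Algebra.algebraMap_self, RingHom.id_apply, ← map_pow,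
      ← map_sub, ← map_pow, AdjoinRoot.mk_eq_zero]
    exact hk
  have hder : IsUnit (aeval (AdjoinRoot.mk p q)
      (derivative (X ^ 2 - C (AdjoinRoot.mk p X) : (AdjoinRoot p)[X]))) := by
    have h2 : IsUnit (2 : AdjoinRoot p) := by
      have := (IsUnit.mk0 (2 : ℂ) two_ne_zero).map (algebraMap ℂ (AdjoinRoot p))
      rwa [map_ofNat] at this
    have : aeval (AdjoinRoot.mk p q) (derivative (X ^ 2 - C (AdjoinRoot.mk p X) :
        (AdjoinRoot p)[X])) = 2 * AdjoinRoot.mk p q := by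
      simp [one_add_one_eq_two]
    rw [this]
    exact h2.mul hunit
  obtain ⟨r, ⟨⟨m, hm⟩, hr⟩, -⟩ := existsUnique_nilpotent_sub_and_aeval_eq_zero hnil hder
  obtain ⟨g, rfl⟩ := AdjoinRoot.mk_surjective r
  refine ⟨g, ?_, fun z hz => ?_⟩
  · rw [map_sub, map_pow, aeval_X, aeval_C, Algebra.algebraMap_self, RingHom.id_apply, ← map_pow,
      ← map_sub, AdjoinRoot.mk_eq_zero] at hr
    exact hr
  · rw [← map_sub, ← map_pow, AdjoinRoot.mk_eq_zero] at hm
    have h1 : ((q - g) ^ m).eval z = 0 := eval_eq_zero_of_dvd_of_eval_eq_zero hm hz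
    rw [eval_pow, eval_sub] at h1
    rw [← hqz z hz]
    exact (sub_eq_zero.1 (eq_zero_of_pow_eq_zero h1)).symm

open Polynomial in
-- The root is a polynomial in `A`: a square root of the variable modulo the characteristic
-- polynomial, taking at each eigenvalue the scalar root in the right half-plane. No
-- diagonalizability is needed.
theorem existsUnique_isPrincipalSqrt {n : ℕ} (hn : 0 < n) {A : Matrix (Fin n) (Fin n) ℂ}
    (hA : ∀ z ∈ spectrum ℂ A, z ∈ Complex.slitPlane) : ∃! X, IsPrincipalSqrt A X := by
  have : Nonempty (Fin n) := ⟨⟨0, hn⟩⟩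
  have hz : ∀ z : ℂ, ∃ w : ℂ, z ∈ Complex.slitPlane → w ^ 2 = z ∧ 0 < w.re := by
    intro z
    by_cases h : z ∈ Complex.slitPlane
    · obtain ⟨w, hw⟩ := exists_sq_eq_re_pos h
      exact ⟨w, fun _ => hw⟩
    · exact ⟨0, fun h' => absurd h' h⟩
  choose f hf using hz
  have hroot : ∀ z, A.charpoly.IsRoot z → z ∈ Complex.slitPlane := fun z hz =>
    hA z (Matrix.mem_spectrum_iff_isRoot_charpoly.2 hz)
  obtain ⟨g, hg, hgz⟩ := exists_sq_sub_X_dvd A.charpoly_monic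
    (fun h0 => Complex.zero_notMem_slitPlane (hroot 0 h0)) f fun z hz => (hf z (hroot z hz)).1
  suffices h : IsPrincipalSqrt A (aeval A g) from ⟨_, h, fun Y hY => hY.unique h⟩
  refine ⟨fun z hz => ?_, ?_⟩
  · rw [spectrum.map_polynomial_aeval_of_nonempty A _
      (spectrum.nonempty_of_isAlgClosed_of_finiteDimensional ℂ A)] at hz
    obtain ⟨a, ha, rfl⟩ := hz
    simp only [hgz a (Matrix.mem_spectrum_iff_isRoot_charpoly.1 ha)]
    exact (hf a (hA a ha)).2
  · obtain ⟨b, hb⟩ := hg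
    have := congrArg (aeval A) hb
    rw [map_mul, Matrix.aeval_self_charpoly, zero_mul, map_sub, map_pow, aeval_X] at this
    exact sub_eq_zero.1 this

theorem isPrincipalSqrt_principalSqrt {n : ℕ} {A : Matrix (Fin n) (Fin n) ℂ}
    (h : ∃! X, IsPrincipalSqrt A X) : IsPrincipalSqrt A (principalSqrt A) := by
  rw [principalSqrt, dif_pos h]
  exact h.choose_spec.1

/-! ### Energy estimates for the telegrapher's equations. -/

/-- For a weight with `|W| ≤ 1` and `|W'| ≤ τ`, the function `F + ε W E` is nondecreasing. A weight
vanishing at one end isolates `E` at the other. Since dissipation and the rate of change of `E` both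
scale with `τ`, the factor `c / (1 + k)` does not involve `τ`. -/
theorem le_sub_of_weighted_energy {F E F' E' : ℝ → ℝ} {c k τ d : ℝ} (hc : 0 ≤ c) (hk : 0 ≤ k)
    (hτ : 0 ≤ τ) (hd : 0 ≤ d) (hF : ∀ t, HasDerivAt F (F' t) t) (hE : ∀ t, HasDerivAt E (E' t) t)
    (hE0 : ∀ t, 0 ≤ E t) (hF' : ∀ t, c * τ * E t ≤ F' t) (hE' : ∀ t, |E' t| ≤ k * τ * E t) :
    c / (1 + k) * (1 - Real.exp (-(τ * d))) * E d ≤ F d - F 0 ∧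
      c / (1 + k) * (1 - Real.exp (-(τ * d))) * E 0 ≤ F d - F 0 := by
  -- Chosen so that `ε (τ + k τ) = c τ`: the weighted energy consumes exactly the available
  -- dissipation.
  set ε := c / (1 + k) with hε
  have hε0 : 0 ≤ ε := by positivity
  have hεk : ε * (1 + k) = c := by rw [hε]; field_simp
  have main : ∀ t, ∀ q p : ℝ, |p| ≤ 1 → |q| ≤ τ → 0 ≤ F' t + ε * (q * E t + p * E' t) := by
    intro t q p hp hq
    have h1 : |q * E t| ≤ τ * E t := by
      rw [abs_mul, abs_of_nonneg (hE0 t)]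
      exact mul_le_mul_of_nonneg_right hq (hE0 t)
    have h2 : |p * E' t| ≤ k * τ * E t := by
      rw [abs_mul]
      calc |p| * |E' t| ≤ 1 * |E' t| := mul_le_mul_of_nonneg_right hp (abs_nonneg _)
        _ ≤ k * τ * E t := by rw [one_mul]; exact hE' t
    have h3 : -((1 + k) * (τ * E t)) ≤ q * E t + p * E' t := by
      linarith [neg_le_of_abs_le h1, neg_le_of_abs_le h2]
    have h4 := mul_le_mul_of_nonneg_left h3 hε0
    have h5 : ε * -((1 + k) * (τ * E t)) = -(c * τ * E t) := by rw [← hεk]; ring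
    linarith [hF' t]
  have hexp : ∀ x : ℝ, 0 ≤ x → Real.exp (-(τ * x)) ≤ 1 := fun x hx =>
    Real.exp_le_one_iff.2 (by nlinarith)
  have mono : ∀ W W' : ℝ → ℝ, (∀ t, HasDerivAt W (W' t) t) →
      (∀ t ∈ Set.Icc 0 d, |W t| ≤ 1 ∧ |W' t| ≤ τ) →
      F 0 + ε * (W 0 * E 0) ≤ F d + ε * (W d * E d) := by
    intro W W' hW hb
    have hder : ∀ t, HasDerivAt (fun t => F t + ε * (W t * E t))
        (F' t + ε * (W' t * E t + W t * E' t)) t := fun t =>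
      (hF t).add (((hW t).mul (hE t)).const_mul ε)
    refine monotoneOn_of_deriv_nonneg (convex_Icc 0 d)
      (fun t _ => (hder t).continuousAt.continuousWithinAt)
      (fun t _ => (hder t).differentiableAt.differentiableWithinAt) (fun t ht => ?_)
      (Set.left_mem_Icc.2 hd) (Set.right_mem_Icc.2 hd) hd
    rw [(hder t).deriv]
    have := hb t (interior_subset ht)
    exact main t _ _ this.1 this.2
  constructor
  -- Weight vanishing at `0`, for the bound by `E d`.
  · have := mono (fun t => Real.exp (-(τ * t)) - 1) (fun t => Real.exp (-(τ * t)) * -(τ * 1))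
      (fun t => (((hasDerivAt_id t).const_mul τ).neg.exp).sub_const 1) (fun t ht => by
        have h1 := hexp t ht.1
        have h2 := Real.exp_pos (-(τ * t))
        refine ⟨abs_le.2 ⟨by linarith, by linarith⟩, ?_⟩
        rw [abs_mul, abs_of_pos h2, mul_one, abs_neg, abs_of_nonneg hτ]
        exact mul_le_of_le_one_left hτ h1)
    simp only [mul_zero, neg_zero, Real.exp_zero, sub_self, zero_mul, add_zero] at this
    linarith
  -- Weight vanishing at `d`, for the bound by `E 0`.
  · have hder : ∀ t, HasDerivAt (fun t => 1 - Real.exp (-(τ * (d - t))))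
        (-(Real.exp (-(τ * (d - t))) * -(τ * -1))) t := fun t =>
      ((((hasDerivAt_id t).const_sub d).const_mul τ).neg.exp).const_sub 1
    have := mono _ _ hder (fun t ht => by
        have h1 := hexp (d - t) (by linarith [ht.2])
        have h2 := Real.exp_pos (-(τ * (d - t)))
        refine ⟨abs_le.2 ⟨by linarith, by linarith⟩, ?_⟩
        rw [abs_neg, abs_mul, abs_of_pos h2, mul_neg_one, neg_neg, abs_of_nonneg hτ]
        exact mul_le_of_le_one_left hτ h1)
    simp only [mul_zero, neg_zero, Real.exp_zero, sub_self, zero_mul, add_zero, sub_zero] at this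
    linarith

section Energy

variable {H : Type*} [NormedAddCommGroup H] [InnerProductSpace ℂ H]

local notation "⟪" x ", " y "⟫" => inner ℂ x y

theorem norm_inner_apply_le {A B : H →L[ℂ] H} {b : ℝ} (hA : ‖A‖ ≤ b) (hB : ‖B‖ ≤ b) (x y : H) :
    ‖⟪A x, B y⟫‖ ≤ b ^ 2 * (‖x‖ * ‖y‖) := by
  calc ‖⟪A x, B y⟫‖ ≤ ‖A x‖ * ‖B y‖ := norm_inner_le_norm _ _
    _ ≤ (b * ‖x‖) * (b * ‖y‖) := mul_le_mul (A.le_of_opNorm_le hA x) (B.le_of_opNorm_le hB y)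
        (norm_nonneg _) ((norm_nonneg _).trans (A.le_of_opNorm_le hA x))
    _ = _ := by ring

/-- This is the derivative of the stored energy. With `a = ⟪C u, L w⟫` the terms in `s` are `2 Re (s
a) + 2 Re (s ā) = 4 Re s Re a`, so `Im s` cancels. -/
theorem abs_re_cross_le {L C R G : H →L[ℂ] H} {b : ℝ} (hLb : ‖L‖ ≤ b) (hCb : ‖C‖ ≤ b)
    (hRb : ‖R‖ ≤ b) (hGb : ‖G‖ ≤ b) (s : ℂ) (u w : H) :
    |2 * (⟪C u, s • L w + R w⟫).re + 2 * (⟪L w, s • C u + G u⟫).re| ≤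
      2 * b ^ 2 * (1 + |s.re|) * (‖u‖ ^ 2 + ‖w‖ ^ 2) := by
  have e : 2 * (⟪C u, s • L w + R w⟫).re + 2 * (⟪L w, s • C u + G u⟫).re =
      4 * s.re * (⟪C u, L w⟫).re + 2 * (⟪C u, R w⟫).re + 2 * (⟪L w, G u⟫).re := by
    rw [inner_add_right, inner_add_right, inner_smul_right, inner_smul_right,
      ← inner_conj_symm (L w) (C u)]
    simp only [Complex.add_re, Complex.mul_re, Complex.conj_re, Complex.conj_im]
    ring
  have h1 : |(⟪C u, L w⟫).re| ≤ b ^ 2 * (‖u‖ * ‖w‖) :=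
    (Complex.abs_re_le_norm _).trans (norm_inner_apply_le hCb hLb u w)
  have h2 : |(⟪C u, R w⟫).re| ≤ b ^ 2 * (‖u‖ * ‖w‖) :=
    (Complex.abs_re_le_norm _).trans (norm_inner_apply_le hCb hRb u w)
  have h3 : |(⟪L w, G u⟫).re| ≤ b ^ 2 * (‖u‖ * ‖w‖) := by
    rw [mul_comm ‖u‖]
    exact (Complex.abs_re_le_norm _).trans (norm_inner_apply_le hLb hGb w u)
  have h4 : ‖u‖ * ‖w‖ ≤ (‖u‖ ^ 2 + ‖w‖ ^ 2) / 2 := by nlinarith [sq_nonneg (‖u‖ - ‖w‖)]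
  rw [e]
  calc |4 * s.re * (⟪C u, L w⟫).re + 2 * (⟪C u, R w⟫).re + 2 * (⟪L w, G u⟫).re|
      ≤ |4 * s.re * (⟪C u, L w⟫).re| + |2 * (⟪C u, R w⟫).re| + |2 * (⟪L w, G u⟫).re| :=
        abs_add_three _ _ _
    _ = 4 * |s.re| * |(⟪C u, L w⟫).re| + 2 * |(⟪C u, R w⟫).re| + 2 * |(⟪L w, G u⟫).re| := by
        simp only [abs_mul, abs_of_pos (zero_lt_four' ℝ), abs_of_pos (zero_lt_two' ℝ)]
    _ ≤ 4 * |s.re| * (b ^ 2 * (‖u‖ * ‖w‖)) + 2 * (b ^ 2 * (‖u‖ * ‖w‖)) +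
          2 * (b ^ 2 * (‖u‖ * ‖w‖)) := by gcongr
    _ = 4 * b ^ 2 * (1 + |s.re|) * (‖u‖ * ‖w‖) := by ring
    _ ≤ 4 * b ^ 2 * (1 + |s.re|) * ((‖u‖ ^ 2 + ‖w‖ ^ 2) / 2) := by gcongr
    _ = _ := by ring

/-- Dissipation along the telegrapher's equations `u' = (L s + R) w`, `w' = (C s + G) u`, bounded
below by the energy at either end with a constant that does not involve `Im s`. -/
theorem energy_le_dissipation {L C R G : H →L[ℂ] H} (hL : ∀ x y, ⟪L x, y⟫ = ⟪x, L y⟫)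
    (hC : ∀ x y, ⟪C x, y⟫ = ⟪x, C y⟫) {b l c δ d : ℝ} (hb : 0 < b) (hl : 0 < l) (hc : 0 ≤ c)
    (hLb : ‖L‖ ≤ b) (hCb : ‖C‖ ≤ b) (hRb : ‖R‖ ≤ b) (hGb : ‖G‖ ≤ b)
    (hLl : ∀ x, l * ‖x‖ ^ 2 ≤ (⟪x, L x⟫).re) (hCl : ∀ x, l * ‖x‖ ^ 2 ≤ (⟪x, C x⟫).re) {s : ℂ}
    (hZ : ∀ x, c * (1 + |s.re|) * ‖x‖ ^ 2 ≤ (⟪x, s • L x + R x⟫).re)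
    (hP : ∀ x, c * (1 + |s.re|) * ‖x‖ ^ 2 ≤ (⟪x, s • C x + G x⟫).re)
    (hδ : 0 ≤ δ) (hδd : δ ≤ d) {u w : ℝ → H}
    (hu : ∀ t, HasDerivAt u (s • L (w t) + R (w t)) t)
    (hw : ∀ t, HasDerivAt w (s • C (u t) + G (u t)) t) :
    let μ := c / b / (1 + 2 * b ^ 2 / l) * (1 - Real.exp (-δ)) * l
    μ * (‖u d‖ ^ 2 + ‖w d‖ ^ 2) ≤ (⟪u d, w d⟫).re - (⟪u 0, w 0⟫).re ∧
      μ * (‖u 0‖ ^ 2 + ‖w 0‖ ^ 2) ≤ (⟪u d, w d⟫).re - (⟪u 0, w 0⟫).re := by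
  intro μ
  set τ := 1 + |s.re| with hτ
  have hτ1 : 1 ≤ τ := by linarith [abs_nonneg s.re]
  have hd : 0 ≤ d := hδ.trans hδd
  set E : ℝ → ℝ := fun t => (⟪u t, C (u t)⟫).re + (⟪w t, L (w t)⟫).re with hEdef
  have hEl : ∀ t, l * (‖u t‖ ^ 2 + ‖w t‖ ^ 2) ≤ E t := fun t => by
    linarith [hCl (u t), hLl (w t)]
  have hEb : ∀ t, E t ≤ b * (‖u t‖ ^ 2 + ‖w t‖ ^ 2) := by
    have : ∀ A : H →L[ℂ] H, ‖A‖ ≤ b → ∀ x, (⟪x, A x⟫).re ≤ b * ‖x‖ ^ 2 := fun A hA x =>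
      calc (⟪x, A x⟫).re ≤ ‖⟪x, A x⟫‖ := Complex.re_le_norm _
        _ ≤ ‖x‖ * ‖A x‖ := norm_inner_le_norm _ _
        _ ≤ ‖x‖ * (b * ‖x‖) := by gcongr; exact A.le_of_opNorm_le hA x
        _ = _ := by ring
    intro t
    linarith [this C hCb (u t), this L hLb (w t)]
  have hE0 : ∀ t, 0 ≤ E t := fun t => le_trans (by positivity) (hEl t)
  have hre : ∀ {f : ℝ → ℂ} {f' : ℂ} {t : ℝ}, HasDerivAt f f' t →
      HasDerivAt (fun t => (f t).re) f'.re t := fun h =>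
    (Complex.reCLM.hasFDerivAt.comp_hasDerivAt _ h)
  have happ : ∀ (A : H →L[ℂ] H) {f : ℝ → H} {f' : H} {t : ℝ}, HasDerivAt f f' t →
      HasDerivAt (fun t => A (f t)) (A f') t := fun A _ _ _ h =>
    ((A.restrictScalars ℝ).hasFDerivAt.comp_hasDerivAt _ h)
  have hF : ∀ t, HasDerivAt (fun t => (⟪u t, w t⟫).re)
      ((⟪u t, s • C (u t) + G (u t)⟫).re + (⟪w t, s • L (w t) + R (w t)⟫).re) t := by
    intro t
    convert! hre ((hu t).inner ℂ (hw t)) using 1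
    rw [Complex.add_re, ← inner_conj_symm (s • L (w t) + R (w t)) (w t), Complex.conj_re]
  have hE : ∀ t, HasDerivAt E (2 * (⟪C (u t), s • L (w t) + R (w t)⟫).re +
      2 * (⟪L (w t), s • C (u t) + G (u t)⟫).re) t := by
    intro t
    have h : ∀ (A : H →L[ℂ] H), (∀ x y, ⟪A x, y⟫ = ⟪x, A y⟫) → ∀ {f : ℝ → H} {f' : H},
        HasDerivAt f f' t → HasDerivAt (fun t => (⟪f t, A (f t)⟫).re)
          (2 * (⟪A (f t), f'⟫).re) t := by
      intro A hA f f' hf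
      convert! hre (hf.inner ℂ (happ A hf)) using 1
      rw [Complex.add_re, ← hA, ← inner_conj_symm f' (A (f t)), Complex.conj_re]
      ring
    exact (h C hC (hu t)).add (h L hL (hw t))
  -- The divisions by `b` and `l` convert `‖u‖² + ‖w‖²` into `E`, which lies between `l` and `b`
  -- times that sum.
  have key := le_sub_of_weighted_energy (c := c / b) (k := 2 * b ^ 2 / l) (τ := τ) (d := d)
    (by positivity) (by positivity) (by positivity) hd hF hE hE0 (fun t => ?_) (fun t => ?_)
  -- Since `τ ≥ 1` and `d ≥ δ`, the dependence on `s` and `d` can be dropped.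
  · have hexp : 1 - Real.exp (-δ) ≤ 1 - Real.exp (-(τ * d)) := by
      have : Real.exp (-(τ * d)) ≤ Real.exp (-δ) := Real.exp_le_exp.2 (by nlinarith)
      linarith
    have hexp0 : 0 ≤ 1 - Real.exp (-δ) := by
      have : Real.exp (-δ) ≤ 1 := Real.exp_le_one_iff.2 (by linarith)
      linarith
    have hend : ∀ t, μ * (‖u t‖ ^ 2 + ‖w t‖ ^ 2) ≤
        c / b / (1 + 2 * b ^ 2 / l) * (1 - Real.exp (-(τ * d))) * E t := fun t =>
      calc μ * (‖u t‖ ^ 2 + ‖w t‖ ^ 2)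
          = c / b / (1 + 2 * b ^ 2 / l) * (1 - Real.exp (-δ)) * (l * (‖u t‖ ^ 2 + ‖w t‖ ^ 2)) := by
            ring
        _ ≤ c / b / (1 + 2 * b ^ 2 / l) * (1 - Real.exp (-δ)) * E t :=
            mul_le_mul_of_nonneg_left (hEl t) (by positivity)
        _ ≤ _ := by
            refine mul_le_mul_of_nonneg_right ?_ (hE0 t)
            exact mul_le_mul_of_nonneg_left hexp (by positivity)
    exact ⟨(hend d).trans key.1, (hend 0).trans key.2⟩
  · calc c / b * τ * E t ≤ c / b * τ * (b * (‖u t‖ ^ 2 + ‖w t‖ ^ 2)) := by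
          gcongr; exact hEb t
      _ = c * τ * ‖u t‖ ^ 2 + c * τ * ‖w t‖ ^ 2 := by field_simp
      _ ≤ _ := add_le_add (hP _) (hZ _)
  · calc _ ≤ 2 * b ^ 2 * τ * (‖u t‖ ^ 2 + ‖w t‖ ^ 2) := abs_re_cross_le hLb hCb hRb hGb s _ _
      _ = 2 * b ^ 2 / l * τ * (l * (‖u t‖ ^ 2 + ‖w t‖ ^ 2)) := by field_simp
      _ ≤ _ := by gcongr; exact hEl t

/-- Cauchy–Schwarz gives `μ ‖w‖² ≤ ‖u‖ ‖w‖`, and then `(μ ‖x‖)² ≤ μ ‖u‖ ‖w‖ ≤ ‖u‖²`. -/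
theorem bounds_of_dissipation {μ : ℝ} (hμ : 0 < μ) {u w x : H}
    (h1 : μ * (‖u‖ ^ 2 + ‖w‖ ^ 2) ≤ (⟪u, w⟫).re) (h2 : μ * ‖x‖ ^ 2 ≤ (⟪u, w⟫).re) :
    μ * ‖w‖ ≤ ‖u‖ ∧ μ * ‖x‖ ≤ ‖u‖ := by
  have h3 : (⟪u, w⟫).re ≤ ‖u‖ * ‖w‖ := (Complex.re_le_norm _).trans (norm_inner_le_norm _ _)
  have h4 : μ * ‖w‖ ≤ ‖u‖ := by
    rcases (norm_nonneg w).eq_or_lt with h | h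
    · rw [← h, mul_zero]; exact norm_nonneg u
    · refine le_of_mul_le_mul_right ?_ h
      nlinarith [mul_nonneg hμ.le (sq_nonneg ‖u‖)]
  refine ⟨h4, ?_⟩
  refine le_of_sq_le_sq ?_ (norm_nonneg u)
  calc (μ * ‖x‖) ^ 2 = μ * (μ * ‖x‖ ^ 2) := by ring
    _ ≤ μ * (‖u‖ * ‖w‖) := mul_le_mul_of_nonneg_left (h2.trans h3) hμ.le
    _ = ‖u‖ * (μ * ‖w‖) := by ring
    _ ≤ ‖u‖ * ‖u‖ := mul_le_mul_of_nonneg_left h4 (norm_nonneg u)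
    _ = ‖u‖ ^ 2 := by ring

end Energy

/-! ### Real symmetric matrices as forms on complex vectors; coercivity. -/

open scoped MatrixOrder in
theorem exists_eq_transpose_mul_self_of_posSemidef {n : Type*} [Fintype n] [DecidableEq n]
    {A : Matrix n n ℝ} (hA : A.PosSemidef) : ∃ B : Matrix n n ℝ, A = B.transpose * B := by
  obtain ⟨B, hB⟩ := CStarAlgebra.nonneg_iff_eq_star_mul_self.1 (Matrix.nonneg_iff_posSemidef.2 hA)
  exact ⟨B, by rw [hB, Matrix.star_eq_conjTranspose, Matrix.conjTranspose_eq_transpose_of_trivial]⟩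

section toC

variable {l m n : Type*}

theorem toC_mul [Fintype m] (A : Matrix l m ℝ) (B : Matrix m n ℝ) :
    toC (A * B) = toC A * toC B := Matrix.map_mul (f := Complex.ofRealHom)

theorem toC_conjTranspose (A : Matrix m n ℝ) : (toC A).conjTranspose = toC A.transpose := by
  ext i j
  simp [toC]

theorem toC_one [DecidableEq n] : toC (1 : Matrix n n ℝ) = 1 :=
  Matrix.map_one _ Complex.ofReal_zero Complex.ofReal_one

theorem toC_sub (A B : Matrix m n ℝ) : toC (A - B) = toC A - toC B :=
  Matrix.map_sub _ Complex.ofReal_sub A B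

theorem toC_smul (r : ℝ) (A : Matrix m n ℝ) : toC (r • A) = (r : ℂ) • toC A := by
  ext i j
  simp [toC]

end toC

/-- The operator on Euclidean space of a real matrix regarded as a complex one. -/
noncomputable def opC {n : ℕ} (A : Matrix (Fin n) (Fin n) ℝ) :
    EuclideanSpace ℂ (Fin n) →L[ℂ] EuclideanSpace ℂ (Fin n) :=
  Matrix.toEuclideanCLM (𝕜 := ℂ) (toC A)

/-- The real part of the sesquilinear form of a real matrix, on the diagonal. -/
noncomputable def quad {n : ℕ} (A : Matrix (Fin n) (Fin n) ℝ) (x : EuclideanSpace ℂ (Fin n)) : ℝ :=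
  (inner ℂ x (opC A x)).re

variable {n : ℕ} {A B : Matrix (Fin n) (Fin n) ℝ}

theorem inner_opC_left (hA : A.IsSymm) (x y : EuclideanSpace ℂ (Fin n)) :
    inner ℂ (opC A x) y = inner ℂ x (opC A y) := by
  have h : ContinuousLinearMap.adjoint (opC A) = opC A := by
    rw [← ContinuousLinearMap.star_eq_adjoint, opC, ← map_star, Matrix.star_eq_conjTranspose,
      toC_conjTranspose, hA.eq]
  rw [← ContinuousLinearMap.adjoint_inner_right, h]

theorem toEuclideanCLM_pencil (A B : Matrix (Fin n) (Fin n) ℝ) (s : ℂ)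
    (x : EuclideanSpace ℂ (Fin n)) :
    Matrix.toEuclideanCLM (𝕜 := ℂ) (pencil A B s) x = s • opC A x + opC B x := by
  rw [pencil, map_add, map_smul]
  rfl

theorem re_inner_pencil (hA : A.IsSymm) (s : ℂ) (x : EuclideanSpace ℂ (Fin n)) :
    (inner ℂ x (s • opC A x + opC B x)).re = s.re * quad A x + quad B x := by
  have him : (inner ℂ x (opC A x)).im = 0 := by
    have := inner_conj_symm (𝕜 := ℂ) x (opC A x)
    rw [inner_opC_left hA] at this
    exact Complex.conj_eq_iff_im.1 this
  rw [inner_add_right, inner_smul_right, Complex.add_re, Complex.mul_re, him, mul_zero, sub_zero,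
    quad, quad]

theorem quad_nonneg (hA : A.PosSemidef) (x : EuclideanSpace ℂ (Fin n)) : 0 ≤ quad A x := by
  obtain ⟨B, rfl⟩ := exists_eq_transpose_mul_self_of_posSemidef hA
  have h : opC (B.transpose * B) = ContinuousLinearMap.adjoint (opC B) * opC B := by
    rw [← ContinuousLinearMap.star_eq_adjoint, opC, opC, ← map_star, ← map_mul, toC_mul,
      Matrix.star_eq_conjTranspose, toC_conjTranspose]
  rw [quad, h, mul_apply_eq_comp, ContinuousLinearMap.adjoint_inner_right]
  exact inner_self_nonneg (𝕜 := ℂ)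

theorem quad_sub (A B : Matrix (Fin n) (Fin n) ℝ) (x : EuclideanSpace ℂ (Fin n)) :
    quad (A - B) x = quad A x - quad B x := by
  rw [quad, quad, quad, opC, toC_sub, map_sub, sub_apply, inner_sub_right,
    Complex.sub_re]
  rfl

theorem quad_algebraMap (r : ℝ) (x : EuclideanSpace ℂ (Fin n)) :
    quad (algebraMap ℝ (Matrix (Fin n) (Fin n) ℝ) r) x = r * ‖x‖ ^ 2 := by
  rw [quad, opC, Algebra.algebraMap_eq_smul_one, toC_smul, toC_one, map_smul, map_one,
    smul_apply, one_apply_eq_self, inner_smul_right,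
    inner_self_eq_norm_sq_to_K, Complex.re_ofReal_mul]
  norm_cast

theorem isHermitian_of_isSymm (hA : A.IsSymm) : A.IsHermitian := by
  rw [Matrix.IsHermitian, Matrix.conjTranspose_eq_transpose_of_trivial, hA.eq]

theorem lamMin_mul_le_quad (hA : A.IsSymm) (x : EuclideanSpace ℂ (Fin n)) :
    lamMin A * ‖x‖ ^ 2 ≤ quad A x := by
  have h : (A - algebraMap ℝ _ (lamMin A)).PosSemidef := by
    refine Matrix.posSemidef_iff_isHermitian_and_spectrum_nonneg.2
      ⟨(isHermitian_of_isSymm hA).sub (isHermitian_of_isSymm ?_), ?_⟩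
    · rw [Algebra.algebraMap_eq_smul_one]
      exact Matrix.isSymm_one.smul _
    · rw [← spectrum.sub_singleton_eq]
      rintro _ ⟨a, ha, b, rfl, rfl⟩
      exact sub_nonneg.2 (csInf_le (Matrix.finite_spectrum A).bddBelow ha)
  have := quad_nonneg h x
  rw [quad_sub, quad_algebraMap] at this
  linarith

theorem quad_le_lamMax_mul (hA : A.IsSymm) (x : EuclideanSpace ℂ (Fin n)) :
    quad A x ≤ lamMax A * ‖x‖ ^ 2 := by
  have h : (algebraMap ℝ _ (lamMax A) - A).PosSemidef := by
    refine Matrix.posSemidef_iff_isHermitian_and_spectrum_nonneg.2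
      ⟨(isHermitian_of_isSymm ?_).sub (isHermitian_of_isSymm hA), ?_⟩
    · rw [Algebra.algebraMap_eq_smul_one]
      exact Matrix.isSymm_one.smul _
    · rw [← spectrum.singleton_sub_eq]
      rintro _ ⟨a, rfl, b, hb, rfl⟩
      exact sub_nonneg.2 (le_csSup (Matrix.finite_spectrum A).bddAbove hb)
  have := quad_nonneg h x
  rw [quad_sub, quad_algebraMap] at this
  linarith

theorem spectrum_real_nonempty (hn : 0 < n) (hA : A.IsSymm) : (spectrum ℝ A).Nonempty :=
  ⟨_, (isHermitian_of_isSymm hA).eigenvalues_mem_spectrum_real ⟨0, hn⟩⟩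

theorem lamMin_pos (hn : 0 < n) (hA : A.PosDef) (hs : A.IsSymm) : 0 < lamMin A := by
  have hmem : lamMin A ∈ spectrum ℝ A :=
    (spectrum_real_nonempty hn hs).csInf_mem (Matrix.finite_spectrum A)
  have h0 : 0 ≤ lamMin A :=
    (Matrix.posSemidef_iff_isHermitian_and_spectrum_nonneg.1 hA.posSemidef).2 hmem
  refine h0.lt_of_ne fun h => ?_
  rw [← h] at hmem
  exact spectrum.zero_notMem ℝ hA.isUnit hmem

theorem lamMin_le_lamMax (hn : 0 < n) (hs : A.IsSymm) : lamMin A ≤ lamMax A :=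
  csInf_le_csSup (spectrum_real_nonempty hn hs) (Matrix.finite_spectrum A).bddBelow
    (Matrix.finite_spectrum A).bddAbove

/-- The worst case of `σ * quad A x` is governed by `lamMin A` for `σ ≥ 0` and by `lamMax A` for `σ
≤ 0`; this is why both quotients enter `alpha`. -/
theorem exists_coercive (hn : 0 < n) (hA : A.PosDef) (hAs : A.IsSymm) (hBs : B.IsSymm) {σ : ℝ}
    (h1 : -(lamMin B / lamMax A) < σ) (h2 : -(lamMin B / lamMin A) < σ) :
    ∃ c, 0 < c ∧ ∀ x : EuclideanSpace ℂ (Fin n), c * ‖x‖ ^ 2 ≤ σ * quad A x + quad B x := by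
  have hmin := lamMin_pos hn hA hAs
  have hmax := hmin.trans_le (lamMin_le_lamMax hn hAs)
  rcases le_total 0 σ with hσ | hσ
  · refine ⟨σ * lamMin A + lamMin B, ?_, fun x => ?_⟩
    · rw [← neg_div, div_lt_iff₀ hmin] at h2
      linarith
    · have := mul_le_mul_of_nonneg_left (lamMin_mul_le_quad hAs x) hσ
      linarith [lamMin_mul_le_quad hBs x]
  · refine ⟨σ * lamMax A + lamMin B, ?_, fun x => ?_⟩
    · rw [← neg_div, div_lt_iff₀ hmax] at h1
      linarith
    · have := mul_le_mul_of_nonpos_left (quad_le_lamMax_mul hAs x) hσ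
      linarith [lamMin_mul_le_quad hBs x]

/-- Coercivity at `β` absorbs `1 + β`, and the surplus `(σ - β) * quad A x` supplies the linear
growth in `σ`. -/
theorem exists_coercive_uniform (hn : 0 < n) (hA : A.PosDef) (hAs : A.IsSymm) (hBs : B.IsSymm)
    {β : ℝ} (hβ : 0 ≤ β) (h1 : -(lamMin B / lamMax A) < β) (h2 : -(lamMin B / lamMin A) < β) :
    ∃ c, 0 < c ∧ ∀ σ, β ≤ σ → ∀ x : EuclideanSpace ℂ (Fin n),
      c * (1 + |σ|) * ‖x‖ ^ 2 ≤ σ * quad A x + quad B x := by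
  obtain ⟨c, hc, h⟩ := exists_coercive hn hA hAs hBs h1 h2
  have hmin := lamMin_pos hn hA hAs
  refine ⟨min (c / (1 + β)) (lamMin A), lt_min (by positivity) hmin, fun σ hσ x => ?_⟩
  rw [abs_of_nonneg (hβ.trans hσ)]
  have h3 : min (c / (1 + β)) (lamMin A) * (1 + β) ≤ c := by
    rw [← le_div_iff₀ (by positivity)]
    exact min_le_left _ _
  have h4 : min (c / (1 + β)) (lamMin A) * (σ - β) ≤ lamMin A * (σ - β) :=
    mul_le_mul_of_nonneg_right (min_le_right _ _) (sub_nonneg.2 hσ)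
  calc _ = (min (c / (1 + β)) (lamMin A) * (1 + β) +
        min (c / (1 + β)) (lamMin A) * (σ - β)) * ‖x‖ ^ 2 := by ring
    _ ≤ (c + lamMin A * (σ - β)) * ‖x‖ ^ 2 := by gcongr
    _ = c * ‖x‖ ^ 2 + (σ - β) * (lamMin A * ‖x‖ ^ 2) := by ring
    _ ≤ (β * quad A x + quad B x) + (σ - β) * quad A x :=
        add_le_add (h x) (mul_le_mul_of_nonneg_left (lamMin_mul_le_quad hAs x) (sub_nonneg.2 hσ))
    _ = _ := by ring

theorem lt_of_alpha_lt {L C R G : Matrix (Fin n) (Fin n) ℝ} {σ : ℝ} (h : alpha L C R G < σ) :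
    (-(lamMin G / lamMax C) < σ ∧ -(lamMin G / lamMin C) < σ) ∧
      (-(lamMin R / lamMax L) < σ ∧ -(lamMin R / lamMin L) < σ) := by
  rw [alpha, neg_lt, lt_min_iff, lt_min_iff, lt_min_iff] at h
  simpa only [neg_lt] using h

/-- The product of two matrices with positive definite Hermitian parts has no eigenvalue on the
closed negative real axis. -/
theorem spectrum_mul_subset_slitPlane {P Z : Matrix (Fin n) (Fin n) ℂ}
    (hP : ∀ x : EuclideanSpace ℂ (Fin n), x ≠ 0 →
      0 < (inner ℂ x (Matrix.toEuclideanCLM (𝕜 := ℂ) P x)).re)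
    (hZ : ∀ x : EuclideanSpace ℂ (Fin n), x ≠ 0 →
      0 < (inner ℂ x (Matrix.toEuclideanCLM (𝕜 := ℂ) Z x)).re) :
    ∀ z ∈ spectrum ℂ (P * Z), z ∈ Complex.slitPlane := by
  intro z hz
  by_contra hslit
  rw [Complex.mem_slitPlane_iff, not_or, not_lt, not_not] at hslit
  rw [spectrum.mem_iff, Matrix.isUnit_iff_isUnit_det, isUnit_iff_ne_zero, not_not,
    ← Matrix.exists_mulVec_eq_zero_iff] at hz
  obtain ⟨v, hv, hv0⟩ := hz
  set x : EuclideanSpace ℂ (Fin n) := WithLp.toLp 2 v with hx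
  have hx0 : x ≠ 0 := fun h => hv (by simpa [hx] using h)
  set T := Matrix.toEuclideanCLM (n := Fin n) (𝕜 := ℂ) with hT
  -- Testing `P` on `y = Z x` gives `Re ⟪y, P y⟫ = z Re ⟪x, Z x⟫` for real `z`; both forms are
  -- positive, which excludes `z ≤ 0`.
  have hPZ : T P (T Z x) = z • x := by
    have h1 : T (algebraMap ℂ _ z - P * Z) x = 0 := by
      rw [hx, Matrix.toEuclideanCLM_toLp, hv0]
      rfl
    rw [map_sub, map_mul, Algebra.algebraMap_eq_smul_one, map_smul, map_one] at h1
    exact (sub_eq_zero.1 h1).symm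
  have hZx := hZ x hx0
  have hy0 : T Z x ≠ 0 := fun h => by
    rw [h, inner_zero_right] at hZx
    exact lt_irrefl _ hZx
  have hPy := hP _ hy0
  rw [hPZ, inner_smul_right, Complex.mul_re, hslit.2, zero_mul, sub_zero,
    ← inner_conj_symm, Complex.conj_re] at hPy
  nlinarith [hslit.1]

/-! ### The chain matrix as an exponential, and analyticity. -/

theorem hasDerivAt_exp_ofReal_smul {m : Type*} [Fintype m] [DecidableEq m] (X : Matrix m m ℂ)
    (t : ℝ) : HasDerivAt (fun u : ℝ => NormedSpace.exp ((u : ℂ) • X))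
      (X * NormedSpace.exp ((t : ℂ) • X)) t :=
  hasDerivAt_exp_smul_const' (𝕂 := ℝ) X t

theorem hasDerivAt_exp_neg_ofReal_smul {m : Type*} [Fintype m] [DecidableEq m] (X : Matrix m m ℂ)
    (t : ℝ) : HasDerivAt (fun u : ℝ => NormedSpace.exp (-((u : ℂ) • X)))
      (-X * NormedSpace.exp (-((t : ℂ) • X))) t := by
  simpa only [smul_neg] using hasDerivAt_exp_ofReal_smul (-X) t

theorem hasDerivAt_mcosh (X : Matrix (Fin n) (Fin n) ℂ) (t : ℝ) :
    HasDerivAt (fun u : ℝ => mcosh ((u : ℂ) • X)) (X * msinh ((t : ℂ) • X)) t := by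
  convert! ((hasDerivAt_exp_ofReal_smul X t).add
    (hasDerivAt_exp_neg_ofReal_smul X t)).const_smul (1 / 2 : ℂ) using 1
  rw [msinh, mul_smul_comm, mul_sub, neg_mul, sub_eq_add_neg]

theorem hasDerivAt_msinh (X : Matrix (Fin n) (Fin n) ℂ) (t : ℝ) :
    HasDerivAt (fun u : ℝ => msinh ((u : ℂ) • X)) (X * mcosh ((t : ℂ) • X)) t := by
  convert! ((hasDerivAt_exp_ofReal_smul X t).sub
    (hasDerivAt_exp_neg_ofReal_smul X t)).const_smul (1 / 2 : ℂ) using 1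
  rw [mcosh, mul_smul_comm, mul_add, neg_mul, sub_neg_eq_add]

theorem mcosh_zero : mcosh (0 : Matrix (Fin n) (Fin n) ℂ) = 1 := by
  rw [mcosh, neg_zero, NormedSpace.exp_zero, ← two_smul ℂ, smul_smul]
  norm_num

theorem msinh_zero : msinh (0 : Matrix (Fin n) (Fin n) ℂ) = 0 := by
  rw [msinh, neg_zero, sub_self, smul_zero]

theorem IsPrincipalSqrt.isUnit {A X : Matrix (Fin n) (Fin n) ℂ}
    (h : IsPrincipalSqrt A X) : IsUnit X := by
  rw [← spectrum.zero_notMem_iff ℂ]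
  intro h0
  simpa using h.1 0 h0

variable {L C R G : Matrix (Fin n) (Fin n) ℝ} {s : ℂ}

theorem Bd_zero (L C R G : Matrix (Fin n) (Fin n) ℝ) (s : ℂ) : Bd L C R G 0 s = 0 := by
  rw [Bd, Complex.ofReal_zero, zero_smul, msinh_zero, mul_zero]

theorem Dd_zero (L C R G : Matrix (Fin n) (Fin n) ℝ) (s : ℂ) : Dd L C R G 0 s = 1 := by
  rw [Dd, Complex.ofReal_zero, zero_smul, mcosh_zero]

theorem hasDerivAt_Bd (hQ : ∃! X, IsPrincipalSqrt (pencil C G s * pencil L R s) X) (t : ℝ) :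
    HasDerivAt (fun d : ℝ => Bd L C R G d s) (pencil L R s * Dd L C R G t s) t := by
  have hu := (isPrincipalSqrt_principalSqrt hQ).isUnit
  convert! (hasDerivAt_msinh (rootCL L C R G s) t).const_mul (Zc L C R G s) using 1
  rw [Zc, Dd, ← mul_assoc, mul_assoc (pencil L R s), rootCL,
    Matrix.nonsing_inv_mul _ ((Matrix.isUnit_iff_isUnit_det _).1 hu), mul_one]

/-- Here `Q sinh = Q² Q⁻¹ sinh`, and `Q²` is the product of the two pencils. -/
theorem hasDerivAt_Dd (hQ : ∃! X, IsPrincipalSqrt (pencil C G s * pencil L R s) X) (t : ℝ) :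
    HasDerivAt (fun d : ℝ => Dd L C R G d s) (pencil C G s * Bd L C R G t s) t := by
  have h := isPrincipalSqrt_principalSqrt hQ
  convert! hasDerivAt_mcosh (rootCL L C R G s) t using 1
  rw [Bd, Zc, ← mul_assoc, ← mul_assoc, ← h.2, rootCL, sq, mul_assoc (principalSqrt _),
    Matrix.mul_nonsing_inv _ ((Matrix.isUnit_iff_isUnit_det _).1 h.isUnit), mul_one]

/-- The generator of the telegrapher's equations. -/
def generator (L C R G : Matrix (Fin n) (Fin n) ℝ) (s : ℂ) :
    Matrix (Fin n ⊕ Fin n) (Fin n ⊕ Fin n) ℂ :=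
  Matrix.fromBlocks 0 (pencil L R s) (pencil C G s) 0

/-- The assembly of a square matrix from four square blocks, as a continuous linear map. -/
noncomputable def blocksCLM (n : ℕ) :
    (Matrix (Fin n) (Fin n) ℂ × Matrix (Fin n) (Fin n) ℂ) ×
      (Matrix (Fin n) (Fin n) ℂ × Matrix (Fin n) (Fin n) ℂ) →L[ℂ]
      Matrix (Fin n ⊕ Fin n) (Fin n ⊕ Fin n) ℂ :=
  LinearMap.toContinuousLinearMap
    { toFun := fun p => Matrix.fromBlocks p.1.1 p.1.2 p.2.1 p.2.2
      map_add' := fun _ _ => (Matrix.fromBlocks_add _ _ _ _ _ _ _ _).symm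
      map_smul' := fun _ _ => (Matrix.fromBlocks_smul _ _ _ _ _).symm }

theorem hasDerivAt_fromBlocks {f g : ℝ → Matrix (Fin n) (Fin n) ℂ}
    {f' g' : Matrix (Fin n) (Fin n) ℂ} {t : ℝ} (hf : HasDerivAt f f' t) (hg : HasDerivAt g g' t) :
    HasDerivAt (fun t => Matrix.fromBlocks (l := Fin n) 0 (f t) 0 (g t))
      (Matrix.fromBlocks (l := Fin n) 0 f' 0 g') t := by
  have h0 : HasDerivAt (fun _ : ℝ => (0 : Matrix (Fin n) (Fin n) ℂ)) 0 t := hasDerivAt_const t 0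
  exact ((blocksCLM n).restrictScalars ℝ).hasFDerivAt.comp_hasDerivAt t
    ((h0.prodMk hf).prodMk (h0.prodMk hg))

theorem generator_mul_fromBlocks (X Y : Matrix (Fin n) (Fin n) ℂ) :
    generator L C R G s * Matrix.fromBlocks (l := Fin n) 0 X 0 Y =
      Matrix.fromBlocks (l := Fin n) 0 (pencil L R s * Y) 0 (pencil C G s * X) := by
  rw [generator, Matrix.fromBlocks_multiply]
  simp

/-- A solution of `W' = M W` is determined by its initial value. -/
theorem eq_exp_mul_of_hasDerivAt {m : Type*} [Fintype m] [DecidableEq m] {M : Matrix m m ℂ}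
    {W : ℝ → Matrix m m ℂ} (hW : ∀ t, HasDerivAt W (M * W t) t) (d : ℝ) :
    W d = NormedSpace.exp ((d : ℂ) • M) * W 0 := by
  -- Variation of constants: `exp(-t M) W(t)` does not depend on `t`.
  have hder : ∀ t : ℝ, HasDerivAt (fun t : ℝ => NormedSpace.exp (-((t : ℂ) • M)) * W t) 0 t := by
    intro t
    convert! (hasDerivAt_exp_neg_ofReal_smul M t).mul (hW t) using 1
    have h3 : Commute M (NormedSpace.exp (-((t : ℂ) • M))) :=
      (((Commute.refl M).smul_right (t : ℂ)).neg_right).exp_right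
    rw [neg_mul, h3.eq, neg_mul, mul_assoc, neg_add_cancel]
  have hconst := is_const_of_deriv_eq_zero (fun t => (hder t).differentiableAt)
    (fun t => (hder t).deriv) d 0
  simp only [Complex.ofReal_zero, zero_smul, neg_zero, NormedSpace.exp_zero, one_mul] at hconst
  let _ : NormedAlgebra ℚ (Matrix m m ℂ) := NormedAlgebra.restrictScalars ℚ ℂ _
  have hinv : NormedSpace.exp ((d : ℂ) • M) * NormedSpace.exp (-((d : ℂ) • M)) = 1 := by
    rw [← NormedSpace.exp_add_of_commute (Commute.refl _).neg_right, add_neg_cancel,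
      NormedSpace.exp_zero]
  rw [← hconst, ← mul_assoc, hinv, one_mul]

theorem fromBlocks_Bd_Dd (hQ : ∃! X, IsPrincipalSqrt (pencil C G s * pencil L R s) X) (d : ℝ) :
    Matrix.fromBlocks (l := Fin n) 0 (Bd L C R G d s) 0 (Dd L C R G d s) =
      NormedSpace.exp ((d : ℂ) • generator L C R G s) *
        Matrix.fromBlocks (l := Fin n) 0 0 0 1 := by
  have h := eq_exp_mul_of_hasDerivAt (M := generator L C R G s)
    (W := fun t => Matrix.fromBlocks (l := Fin n) 0 (Bd L C R G t s) 0 (Dd L C R G t s))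
    (fun t => by
      rw [generator_mul_fromBlocks]
      exact hasDerivAt_fromBlocks (hasDerivAt_Bd hQ t) (hasDerivAt_Dd hQ t)) d
  rwa [Bd_zero, Dd_zero] at h

/-- The right-hand side no longer contains the square root and is entire in `s`. -/
theorem Bd_eq_toBlocks (hQ : ∃! X, IsPrincipalSqrt (pencil C G s * pencil L R s) X) (d : ℝ) :
    Bd L C R G d s =
      (NormedSpace.exp ((d : ℂ) • generator L C R G s)).toBlocks₁₂ := by
  have h := congrArg Matrix.toBlocks₁₂ (fromBlocks_Bd_Dd hQ d)
  rw [← Matrix.fromBlocks_toBlocks (NormedSpace.exp ((d : ℂ) • generator L C R G s)),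
    Matrix.fromBlocks_multiply] at h
  simpa using h

theorem Dd_eq_toBlocks (hQ : ∃! X, IsPrincipalSqrt (pencil C G s * pencil L R s) X) (d : ℝ) :
    Dd L C R G d s =
      (NormedSpace.exp ((d : ℂ) • generator L C R G s)).toBlocks₂₂ := by
  have h := congrArg Matrix.toBlocks₂₂ (fromBlocks_Bd_Dd hQ d)
  rw [← Matrix.fromBlocks_toBlocks (NormedSpace.exp ((d : ℂ) • generator L C R G s)),
    Matrix.fromBlocks_multiply] at h
  simpa using h

/-- The admittance matrix as a function of the chain matrix. -/
noncomputable def admittanceOfChain (E : Matrix (Fin n ⊕ Fin n) (Fin n ⊕ Fin n) ℂ) :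
    Matrix (Fin n ⊕ Fin n) (Fin n ⊕ Fin n) ℂ :=
  Matrix.fromBlocks (E.toBlocks₂₂ * E.toBlocks₁₂⁻¹) (-E.toBlocks₁₂⁻¹) (-E.toBlocks₁₂⁻¹)
    (E.toBlocks₂₂ * E.toBlocks₁₂⁻¹)

theorem analyticAt_admittanceOfChain {E : Matrix (Fin n ⊕ Fin n) (Fin n ⊕ Fin n) ℂ}
    (hE : IsUnit E.toBlocks₁₂) : AnalyticAt ℂ admittanceOfChain E := by
  have h12 : AnalyticAt ℂ (fun E : Matrix (Fin n ⊕ Fin n) (Fin n ⊕ Fin n) ℂ => E.toBlocks₁₂) E :=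
    (LinearMap.toContinuousLinearMap (𝕜 := ℂ)
      { toFun := fun E : Matrix (Fin n ⊕ Fin n) (Fin n ⊕ Fin n) ℂ => E.toBlocks₁₂
        map_add' := fun _ _ => rfl
        map_smul' := fun _ _ => rfl }).analyticAt E
  have h22 : AnalyticAt ℂ (fun E : Matrix (Fin n ⊕ Fin n) (Fin n ⊕ Fin n) ℂ => E.toBlocks₂₂) E :=
    (LinearMap.toContinuousLinearMap (𝕜 := ℂ)
      { toFun := fun E : Matrix (Fin n ⊕ Fin n) (Fin n ⊕ Fin n) ℂ => E.toBlocks₂₂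
        map_add' := fun _ _ => rfl
        map_smul' := fun _ _ => rfl }).analyticAt E
  have hinv : AnalyticAt ℂ
      (fun E : Matrix (Fin n ⊕ Fin n) (Fin n ⊕ Fin n) ℂ => E.toBlocks₁₂⁻¹) E := by
    simp only [Matrix.nonsing_inv_eq_ringInverse]
    have h : AnalyticAt ℂ Ring.inverse E.toBlocks₁₂ := analyticAt_inverse hE.unit
    exact h.fun_comp h12
  exact ((blocksCLM n).analyticAt _).fun_comp
    (((h22.mul hinv).prod hinv.neg).prod (hinv.neg.prod (h22.mul hinv)))

theorem admittance_eq (hQ : ∃! X, IsPrincipalSqrt (pencil C G s * pencil L R s) X) (d : ℝ) :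
    admittance L C R G s d =
      admittanceOfChain (NormedSpace.exp ((d : ℂ) • generator L C R G s)) := by
  rw [admittance, Bd_eq_toBlocks hQ, Dd_eq_toBlocks hQ, admittanceOfChain]

theorem analyticAt_generator (L C R G : Matrix (Fin n) (Fin n) ℝ) (s : ℂ) :
    AnalyticAt ℂ (generator L C R G) s := by
  have h : ∀ A B : Matrix (Fin n) (Fin n) ℝ, AnalyticAt ℂ (pencil A B) s := fun A B =>
    (analyticAt_id.smul analyticAt_const).add analyticAt_const
  exact ((blocksCLM n).analyticAt _).fun_comp
    ((analyticAt_const.prod (h L R)).prod ((h C G).prod analyticAt_const))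

/-! ### Finiteness of `κ`. -/

theorem isUnit_toC_of_transpose_mul_self {A B : Matrix (Fin n) (Fin n) ℝ} (hA : IsUnit A)
    (h : A = B.transpose * B) : IsUnit (toC B) := by
  rw [h, Matrix.isUnit_iff_isUnit_det, Matrix.det_mul] at hA
  have hB : IsUnit B := (Matrix.isUnit_iff_isUnit_det _).2 (isUnit_of_mul_isUnit_right hA)
  exact hB.map (Complex.ofRealHom.mapMatrix (m := Fin n))

theorem norm_exp_I_smul_of_isHermitian {m : Type*} [Fintype m] [DecidableEq m] [Nonempty m]
    {A : Matrix m m ℂ} (hA : A.IsHermitian) : ‖NormedSpace.exp (Complex.I • A)‖ = 1 := by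
  have h := CStarRing.norm_of_mem_unitary
    (selfAdjoint.expUnitary (⟨A, hA⟩ : selfAdjoint (Matrix m m ℂ))).2
  rwa [selfAdjoint.expUnitary_coe] at h

/-- With `L = SᵀS` and `C = TᵀT`, conjugation by `diag(T, S)` turns the lossless generator into `i ω
H` with `H` Hermitian. Its exponential is unitary, so the condition number of `diag(T, S)` bounds
every norm. -/
theorem bddAbove_losslessNorm (hn : 0 < n) (hL : L.PosDef) (hC : C.PosDef) :
    BddAbove (Set.range (losslessNorm L C)) := by
  have : Nonempty (Fin n) := ⟨⟨0, hn⟩⟩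
  obtain ⟨S, hS⟩ := exists_eq_transpose_mul_self_of_posSemidef hL.posSemidef
  obtain ⟨T, hT⟩ := exists_eq_transpose_mul_self_of_posSemidef hC.posSemidef
  have hSu := isUnit_toC_of_transpose_mul_self hL.isUnit hS
  have hTu := isUnit_toC_of_transpose_mul_self hC.isUnit hT
  set K : Matrix (Fin n ⊕ Fin n) (Fin n ⊕ Fin n) ℂ :=
    Matrix.fromBlocks (toC T) 0 0 (toC S) with hK
  set H : Matrix (Fin n ⊕ Fin n) (Fin n ⊕ Fin n) ℂ :=
    Matrix.fromBlocks 0 (toC (T * S.transpose)) (toC (S * T.transpose)) 0 with hH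
  have hKu : IsUnit K := by
    rw [Matrix.isUnit_iff_isUnit_det] at hSu hTu ⊢
    rw [hK, Matrix.det_fromBlocks_zero₂₁]
    exact hTu.mul hSu
  have hHh : H.IsHermitian := by
    rw [Matrix.IsHermitian, hH, Matrix.fromBlocks_conjTranspose, toC_conjTranspose,
      toC_conjTranspose, Matrix.conjTranspose_zero, Matrix.transpose_mul, Matrix.transpose_mul,
      Matrix.transpose_transpose, Matrix.transpose_transpose]
  refine ⟨‖K⁻¹‖ * ‖K‖, ?_⟩
  rintro _ ⟨ω, rfl⟩
  have hconj : Matrix.fromBlocks 0 ((Complex.I * (ω : ℂ)) • toC L)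
      ((Complex.I * (ω : ℂ)) • toC C) 0 = K⁻¹ * (Complex.I • ((ω : ℂ) • H)) * K := by
    have h : K * Matrix.fromBlocks 0 ((Complex.I * (ω : ℂ)) • toC L)
        ((Complex.I * (ω : ℂ)) • toC C) 0 = (Complex.I • ((ω : ℂ) • H)) * K := by
      rw [smul_smul, hH, hK, Matrix.fromBlocks_smul, Matrix.fromBlocks_multiply,
        Matrix.fromBlocks_multiply, hS, hT]
      simp only [toC_mul, mul_zero, zero_mul, add_zero, zero_add, smul_zero, smul_mul_assoc,
        mul_smul_comm, mul_assoc]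
    rw [mul_assoc, ← h, ← mul_assoc,
      Matrix.nonsing_inv_mul _ ((Matrix.isUnit_iff_isUnit_det _).1 hKu), one_mul]
  have hω : ((ω : ℂ) • H).IsHermitian := by
    rw [Matrix.IsHermitian, Matrix.conjTranspose_smul, hHh.eq, Complex.star_def,
      Complex.conj_ofReal]
  rw [losslessNorm, hconj, Matrix.exp_conj' _ _ hKu]
  calc _ ≤ ‖K⁻¹‖ * ‖NormedSpace.exp (Complex.I • ((ω : ℂ) • H))‖ * ‖K‖ :=
        (norm_mul_le _ _).trans (mul_le_mul_of_nonneg_right (norm_mul_le _ _) (norm_nonneg _))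
    _ = _ := by rw [norm_exp_I_smul_of_isHermitian hω, mul_one]

/-! ### Invertibility of `B_d` and uniform bounds on the admittance. -/

/-- Coercivity of the Hermitian part of `A s + B` with a given constant. -/
def Coercive (A B : Matrix (Fin n) (Fin n) ℝ) (c : ℝ) (s : ℂ) : Prop :=
  ∀ x : EuclideanSpace ℂ (Fin n), c * (1 + |s.re|) * ‖x‖ ^ 2 ≤ s.re * quad A x + quad B x

theorem Coercive.re_inner_pos {A B : Matrix (Fin n) (Fin n) ℝ} {c : ℝ} {s : ℂ}
    (h : Coercive A B c s) (hA : A.IsSymm) (hc : 0 < c) (x : EuclideanSpace ℂ (Fin n))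
    (hx : x ≠ 0) : 0 < (inner ℂ x (Matrix.toEuclideanCLM (𝕜 := ℂ) (pencil A B s) x)).re := by
  rw [toEuclideanCLM_pencil, re_inner_pencil hA]
  have h1 : 0 < ‖x‖ := norm_pos_iff.2 hx
  exact lt_of_lt_of_le (by positivity) (h x)

theorem existsUnique_root (hn : 0 < n) (hLs : L.IsSymm) (hCs : C.IsSymm) {c : ℝ} (hc : 0 < c)
    {s : ℂ} (hZ : Coercive L R c s) (hP : Coercive C G c s) :
    ∃! X, IsPrincipalSqrt (pencil C G s * pencil L R s) X :=
  existsUnique_isPrincipalSqrt hn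
    (spectrum_mul_subset_slitPlane (hP.re_inner_pos hCs hc) (hZ.re_inner_pos hLs hc))

theorem hasDerivAt_toEuclideanCLM_apply {f : ℝ → Matrix (Fin n) (Fin n) ℂ}
    {f' : Matrix (Fin n) (Fin n) ℂ} {t : ℝ} (hf : HasDerivAt f f' t)
    (x : EuclideanSpace ℂ (Fin n)) :
    HasDerivAt (fun t => Matrix.toEuclideanCLM (𝕜 := ℂ) (f t) x)
      (Matrix.toEuclideanCLM (𝕜 := ℂ) f' x) t := by
  let Φ : Matrix (Fin n) (Fin n) ℂ →L[ℂ] EuclideanSpace ℂ (Fin n) :=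
    LinearMap.toContinuousLinearMap
      { toFun := fun A => Matrix.toEuclideanCLM (𝕜 := ℂ) A x
        map_add' := fun A B => by rw [map_add]; rfl
        map_smul' := fun a A => by rw [map_smul]; rfl }
  exact (Φ.restrictScalars ℝ).hasFDerivAt.comp_hasDerivAt t hf

/-- Lower bounds for the voltage at the far end of a short-circuited line, uniform in the
frequency. -/
theorem exists_bound_of_coercive (hn : 0 < n) (hLs : L.IsSymm) (hCs : C.IsSymm) (hL : L.PosDef)
    (hC : C.PosDef) (R G : Matrix (Fin n) (Fin n) ℝ) {c δ : ℝ} (hc : 0 < c) (hδ : 0 < δ) :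
    ∃ μ, 0 < μ ∧ ∀ s, Coercive L R c s → Coercive C G c s → ∀ d, δ ≤ d →
      ∀ x : EuclideanSpace ℂ (Fin n),
        μ * ‖Matrix.toEuclideanCLM (𝕜 := ℂ) (Dd L C R G d s) x‖ ≤
            ‖Matrix.toEuclideanCLM (𝕜 := ℂ) (Bd L C R G d s) x‖ ∧
          μ * ‖x‖ ≤ ‖Matrix.toEuclideanCLM (𝕜 := ℂ) (Bd L C R G d s) x‖ := by
  set b := 1 + ‖opC L‖ + ‖opC C‖ + ‖opC R‖ + ‖opC G‖ with hb
  set l := min (lamMin L) (lamMin C) with hl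
  have hl0 : 0 < l := lt_min (lamMin_pos hn hL hLs) (lamMin_pos hn hC hCs)
  have hb0 : 0 < b := by positivity
  have hδ' : 0 < 1 - Real.exp (-δ) := by
    have : Real.exp (-δ) < 1 := Real.exp_lt_one_iff.2 (by linarith)
    linarith
  have hμ : 0 < c / b / (1 + 2 * b ^ 2 / l) * (1 - Real.exp (-δ)) * l := by positivity
  refine ⟨_, hμ, fun s hZ hP d hd x => ?_⟩
  have hQ := existsUnique_root hn hLs hCs hc hZ hP
  have n1 := norm_nonneg (opC L)
  have n2 := norm_nonneg (opC C)
  have n3 := norm_nonneg (opC R)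
  have n4 := norm_nonneg (opC G)
  have key := energy_le_dissipation (L := opC L) (C := opC C) (R := opC R) (G := opC G)
    (inner_opC_left hLs) (inner_opC_left hCs) (b := b) (l := l) (c := c) (δ := δ) (d := d) (s := s)
    hb0 hl0 hc.le (by linarith) (by linarith) (by linarith) (by linarith)
    (fun y => (mul_le_mul_of_nonneg_right (min_le_left _ _) (sq_nonneg _)).trans
      (lamMin_mul_le_quad hLs y))
    (fun y => (mul_le_mul_of_nonneg_right (min_le_right _ _) (sq_nonneg _)).trans
      (lamMin_mul_le_quad hCs y))
    (fun y => (re_inner_pencil hLs s y).symm ▸ hZ y)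
    (fun y => (re_inner_pencil hCs s y).symm ▸ hP y) hδ.le hd
    -- The solution with `u 0 = 0` and `w 0 = x`, so the power flow at `0` vanishes.
    (u := fun t => Matrix.toEuclideanCLM (𝕜 := ℂ) (Bd L C R G t s) x)
    (w := fun t => Matrix.toEuclideanCLM (𝕜 := ℂ) (Dd L C R G t s) x)
    (fun t => by
      rw [← toEuclideanCLM_pencil, ← mul_apply_eq_comp, ← map_mul]
      exact hasDerivAt_toEuclideanCLM_apply (hasDerivAt_Bd hQ t) x)
    (fun t => by
      rw [← toEuclideanCLM_pencil, ← mul_apply_eq_comp, ← map_mul]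
      exact hasDerivAt_toEuclideanCLM_apply (hasDerivAt_Dd hQ t) x)
  simp only [Bd_zero, Dd_zero, map_zero, map_one, zero_apply, one_apply_eq_self, inner_zero_left,
    Complex.zero_re, sub_zero, norm_zero, ne_eq, OfNat.ofNat_ne_zero, not_false_eq_true, zero_pow,
    zero_add] at key
  exact bounds_of_dissipation hμ key.1 key.2

theorem isUnit_Bd_of_bound {d μ : ℝ} {s : ℂ} (hμ : 0 < μ)
    (h : ∀ x : EuclideanSpace ℂ (Fin n),
      μ * ‖x‖ ≤ ‖Matrix.toEuclideanCLM (𝕜 := ℂ) (Bd L C R G d s) x‖) :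
    IsUnit (Bd L C R G d s) := by
  rw [Matrix.isUnit_iff_isUnit_det, isUnit_iff_ne_zero]
  intro h0
  obtain ⟨v, hv, hv0⟩ := Matrix.exists_mulVec_eq_zero_iff.2 h0
  have h1 := h (WithLp.toLp 2 v)
  rw [Matrix.toEuclideanCLM_toLp, hv0, WithLp.toLp_zero, norm_zero] at h1
  have h2 : ‖WithLp.toLp 2 v‖ ≤ 0 := by nlinarith [norm_nonneg (WithLp.toLp 2 v)]
  exact hv (by simpa using norm_le_zero_iff.1 h2)

theorem norm_mul_inv_le_of_bound {X B : Matrix (Fin n) (Fin n) ℂ} (hB : IsUnit B) {μ : ℝ}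
    (hμ : 0 < μ) (h : ∀ x : EuclideanSpace ℂ (Fin n),
      μ * ‖Matrix.toEuclideanCLM (𝕜 := ℂ) X x‖ ≤ ‖Matrix.toEuclideanCLM (𝕜 := ℂ) B x‖) :
    ‖X * B⁻¹‖ ≤ 1 / μ := by
  rw [← Matrix.l2_opNorm_toEuclideanCLM]
  refine ContinuousLinearMap.opNorm_le_bound _ (by positivity) fun x => ?_
  have h1 := h (Matrix.toEuclideanCLM (𝕜 := ℂ) B⁻¹ x)
  rw [← mul_apply_eq_comp, ← mul_apply_eq_comp, ← map_mul, ← map_mul,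
    Matrix.mul_nonsing_inv _ ((Matrix.isUnit_iff_isUnit_det _).1 hB), map_one,
    one_apply_eq_self] at h1
  rw [one_div, inv_mul_eq_div, le_div_iff₀ hμ, mul_comm]
  exact h1

theorem exists_norm_admittance_le (hn : 0 < n) (hLs : L.IsSymm) (hCs : C.IsSymm) (hL : L.PosDef)
    (hC : C.PosDef) (R G : Matrix (Fin n) (Fin n) ℝ) {c δ : ℝ} (hc : 0 < c) (hδ : 0 < δ) :
    ∃ K, 0 < K ∧ ∀ s, Coercive L R c s → Coercive C G c s → ∀ d, δ ≤ d →
      ‖admittance L C R G s d‖ ≤ K := by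
  obtain ⟨μ, hμ, h⟩ := exists_bound_of_coercive hn hLs hCs hL hC R G hc hδ
  -- Each block has norm at most `1 / μ`, and the product space carries the sup norm; the `+ 1`
  -- makes the constant visibly positive.
  refine ⟨(‖blocksCLM n‖ + 1) * (1 / μ), by positivity, fun s hZ hP d hd => ?_⟩
  have hb := h s hZ hP d hd
  have hu := isUnit_Bd_of_bound hμ fun x => (hb x).2
  have h1 : ‖Dd L C R G d s * (Bd L C R G d s)⁻¹‖ ≤ 1 / μ :=
    norm_mul_inv_le_of_bound hu hμ fun x => (hb x).1
  have h2 : ‖-(Bd L C R G d s)⁻¹‖ ≤ 1 / μ := by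
    rw [norm_neg, ← one_mul (Bd L C R G d s)⁻¹]
    exact norm_mul_inv_le_of_bound hu hμ fun x => by
      rw [map_one, one_apply_eq_self]
      exact (hb x).2
  set p := ((Dd L C R G d s * (Bd L C R G d s)⁻¹, -(Bd L C R G d s)⁻¹),
    (-(Bd L C R G d s)⁻¹, Dd L C R G d s * (Bd L C R G d s)⁻¹)) with hp
  have h3 : ‖p‖ ≤ 1 / μ := by
    simp only [hp, Prod.norm_mk, max_le_iff]
    exact ⟨⟨h1, h2⟩, h2, h1⟩
  calc ‖admittance L C R G s d‖ = ‖blocksCLM n p‖ := rfl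
    _ ≤ ‖blocksCLM n‖ * ‖p‖ := (blocksCLM n).le_opNorm p
    _ ≤ (‖blocksCLM n‖ + 1) * (1 / μ) := by gcongr; linarith

/-- The constant depends on `s`, which is enough for invertibility but not for the growth bound. -/
theorem exists_coercive_of_alpha_lt (hn : 0 < n) (hLs : L.IsSymm) (hCs : C.IsSymm)
    (hRs : R.IsSymm) (hGs : G.IsSymm) (hL : L.PosDef) (hC : C.PosDef) {s : ℂ}
    (hs : alpha L C R G < s.re) : ∃ c, 0 < c ∧ Coercive L R c s ∧ Coercive C G c s := by
  obtain ⟨hG', hR'⟩ := lt_of_alpha_lt hs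
  obtain ⟨c₁, hc₁, h₁⟩ := exists_coercive hn hL hLs hRs hR'.1 hR'.2
  obtain ⟨c₂, hc₂, h₂⟩ := exists_coercive hn hC hCs hGs hG'.1 hG'.2
  have h0 : 0 < 1 + |s.re| := by positivity
  refine ⟨min c₁ c₂ / (1 + |s.re|), div_pos (lt_min hc₁ hc₂) h0, fun x => ?_, fun x => ?_⟩
  · rw [div_mul_cancel₀ _ h0.ne']
    exact (mul_le_mul_of_nonneg_right (min_le_left _ _) (sq_nonneg _)).trans (h₁ x)
  · rw [div_mul_cancel₀ _ h0.ne']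
    exact (mul_le_mul_of_nonneg_right (min_le_right _ _) (sq_nonneg _)).trans (h₂ x)

theorem exists_coercive_of_alpha_lt_of_le_re (hn : 0 < n) (hLs : L.IsSymm) (hCs : C.IsSymm)
    (hRs : R.IsSymm) (hGs : G.IsSymm) (hL : L.PosDef) (hC : C.PosDef) {β : ℝ} (hβ : 0 ≤ β)
    (hα : alpha L C R G < β) :
    ∃ c, 0 < c ∧ ∀ s : ℂ, β ≤ s.re → Coercive L R c s ∧ Coercive C G c s := by
  obtain ⟨hG', hR'⟩ := lt_of_alpha_lt hα
  obtain ⟨c₁, hc₁, h₁⟩ := exists_coercive_uniform hn hL hLs hRs hβ hR'.1 hR'.2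
  obtain ⟨c₂, hc₂, h₂⟩ := exists_coercive_uniform hn hC hCs hGs hβ hG'.1 hG'.2
  refine ⟨min c₁ c₂, lt_min hc₁ hc₂, fun s hs => ⟨fun x => le_trans ?_ (h₁ _ hs x),
    fun x => le_trans ?_ (h₂ _ hs x)⟩⟩
  · gcongr
    exact min_le_left _ _
  · gcongr
    exact min_le_right _ _

theorem kappa_nonneg (L C : Matrix (Fin n) (Fin n) ℝ) : 0 ≤ kappa L C :=
  Real.sSup_nonneg (by rintro _ ⟨ω, rfl⟩; exact norm_nonneg _)

/-- Nonnegativity suffices for the final exponent to be nonnegative, also under the convention `x /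
0 = 0`. -/
theorem nu_nonneg (L C : Matrix (Fin n) (Fin n) ℝ) : 0 ≤ nu L C :=
  div_nonneg zero_le_one (mul_nonneg (kappa_nonneg L C) (le_max_of_le_left (norm_nonneg _)))

theorem theta_nonneg (L C R G : Matrix (Fin n) (Fin n) ℝ) : 0 ≤ theta L C R G :=
  div_nonneg (le_max_of_le_left (norm_nonneg _)) (le_max_of_le_left (norm_nonneg _))

end TransmissionLine

theorem theorem3 {n : ℕ} (hn : 0 < n) (L C R G : Matrix (Fin n) (Fin n) ℝ)
    (hLs : L.IsSymm) (hCs : C.IsSymm) (hRs : R.IsSymm) (hGs : G.IsSymm)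
    (hL : L.PosDef) (hC : C.PosDef) :
    -- the principal square root exists uniquely, and `B_d(s)` is invertible
    (∀ s : ℂ, TransmissionLine.alpha L C R G < s.re →
      ∃! X, TransmissionLine.IsPrincipalSqrt
        (TransmissionLine.pencil C G s * TransmissionLine.pencil L R s) X) ∧
    (∀ s : ℂ, TransmissionLine.alpha L C R G < s.re → ∀ d : ℝ, 0 < d →
      IsUnit (TransmissionLine.Bd L C R G d s)) ∧
    -- joint continuity
    ContinuousOn (fun p : ℂ × ℝ => TransmissionLine.admittance L C R G p.1 p.2)
      {p : ℂ × ℝ | TransmissionLine.alpha L C R G < p.1.re ∧ 0 < p.2} ∧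
    -- analyticity in `s`
    (∀ d : ℝ, 0 < d → AnalyticOnNhd ℂ (fun s : ℂ => TransmissionLine.admittance L C R G s d)
      {s : ℂ | TransmissionLine.alpha L C R G < s.re}) ∧
    -- the supremum `κ` is finite, and the growth bound holds
    BddAbove (Set.range (TransmissionLine.losslessNorm L C)) ∧
    (∀ β : ℝ, 0 ≤ β → TransmissionLine.alpha L C R G < β → ∀ δ : ℝ, 0 < δ →
      ∃ M : ℝ, 0 < M ∧ ∀ s : ℂ, β ≤ s.re → ∀ d : ℝ, δ ≤ d →
        ‖TransmissionLine.admittance L C R G s d‖ ≤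
          M * Real.exp ((n : ℝ) * d / TransmissionLine.nu L C *
            (s + (TransmissionLine.theta L C R G : ℂ)).re)) := by
  have hco := fun {s : ℂ} => TransmissionLine.exists_coercive_of_alpha_lt (s := s) hn hLs hCs hRs
    hGs hL hC
  have hroot : ∀ s : ℂ, TransmissionLine.alpha L C R G < s.re →
      ∃! X, TransmissionLine.IsPrincipalSqrt
        (TransmissionLine.pencil C G s * TransmissionLine.pencil L R s) X := by
    intro s hs
    obtain ⟨c, hc, hZ, hP⟩ := hco hs
    exact TransmissionLine.existsUnique_root hn hLs hCs hc hZ hP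
  have hunit : ∀ s : ℂ, TransmissionLine.alpha L C R G < s.re → ∀ d : ℝ, 0 < d →
      IsUnit (TransmissionLine.Bd L C R G d s) := by
    intro s hs d hd
    obtain ⟨c, hc, hZ, hP⟩ := hco hs
    obtain ⟨μ, hμ, h⟩ := TransmissionLine.exists_bound_of_coercive hn hLs hCs hL hC R G hc hd
    exact TransmissionLine.isUnit_Bd_of_bound hμ fun x => (h s hZ hP d le_rfl x).2
  have hchain : ∀ s : ℂ, TransmissionLine.alpha L C R G < s.re → ∀ d : ℝ, 0 < d →
      AnalyticAt ℂ TransmissionLine.admittanceOfChain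
        (NormedSpace.exp ((d : ℂ) • TransmissionLine.generator L C R G s)) := by
    intro s hs d hd
    refine TransmissionLine.analyticAt_admittanceOfChain ?_
    rw [← TransmissionLine.Bd_eq_toBlocks (hroot s hs)]
    exact hunit s hs d hd
  refine ⟨hroot, hunit, ?_, ?_, TransmissionLine.bddAbove_losslessNorm hn hL hC, ?_⟩
  · have hcont : ContinuousOn (fun p : ℂ × ℝ => TransmissionLine.admittanceOfChain
        (NormedSpace.exp ((p.2 : ℂ) • TransmissionLine.generator L C R G p.1)))
        {p : ℂ × ℝ | TransmissionLine.alpha L C R G < p.1.re ∧ 0 < p.2} := by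
      intro p hp
      have h1 : ContinuousAt
          (fun p : ℂ × ℝ => (p.2 : ℂ) • TransmissionLine.generator L C R G p.1) p :=
        (Complex.continuous_ofReal.comp continuous_snd).continuousAt.smul
          ((TransmissionLine.analyticAt_generator L C R G p.1).continuousAt.comp
            continuous_fst.continuousAt)
      have h2 : ContinuousAt (fun p : ℂ × ℝ =>
          NormedSpace.exp ((p.2 : ℂ) • TransmissionLine.generator L C R G p.1)) p :=
        (NormedSpace.exp_analytic (𝕂 := ℂ) _).continuousAt.comp h1
      exact (ContinuousAt.comp (f := fun p : ℂ × ℝ =>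
          NormedSpace.exp ((p.2 : ℂ) • TransmissionLine.generator L C R G p.1))
        (hchain p.1 hp.1 p.2 hp.2).continuousAt h2).continuousWithinAt
    exact hcont.congr fun p hp => TransmissionLine.admittance_eq (hroot p.1 hp.1) p.2
  · intro d hd s hs
    have h1 : AnalyticAt ℂ (fun s => (d : ℂ) • TransmissionLine.generator L C R G s) s :=
      analyticAt_const.fun_smul (TransmissionLine.analyticAt_generator L C R G s)
    have h2 : AnalyticAt ℂ
        (fun s => NormedSpace.exp ((d : ℂ) • TransmissionLine.generator L C R G s)) s :=
      (NormedSpace.exp_analytic (𝕂 := ℂ) _).fun_comp h1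
    refine (AnalyticAt.fun_comp (f := fun s =>
      NormedSpace.exp ((d : ℂ) • TransmissionLine.generator L C R G s))
      (hchain s hs d hd) h2).congr ?_
    -- The chain-matrix formula is available wherever the root exists, and the half-plane is a
    -- neighbourhood of `s`.
    filter_upwards [(isOpen_lt continuous_const Complex.continuous_re).mem_nhds hs] with z hz
    exact (TransmissionLine.admittance_eq (hroot z hz) d).symm
  · intro β hβ hα δ hδ
    obtain ⟨c, hc, h⟩ := TransmissionLine.exists_coercive_of_alpha_lt_of_le_re hn hLs hCs hRs hGs
      hL hC hβ hα
    obtain ⟨K, hK, hY⟩ :=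
      TransmissionLine.exists_norm_admittance_le hn hLs hCs hL hC R G hc hδ
    refine ⟨K, hK, fun s hs d hd => ?_⟩
    -- This is where `β ≥ 0` makes the exponent nonnegative, so the uniform bound `K` serves as `M`.
    have h1 : (1 : ℝ) ≤ Real.exp ((n : ℝ) * d / TransmissionLine.nu L C *
        (s + (TransmissionLine.theta L C R G : ℂ)).re) := by
      rw [Real.one_le_exp_iff, Complex.add_re, Complex.ofReal_re]
      have hs0 : 0 ≤ s.re := hβ.trans hs
      have hd0 : 0 ≤ d := hδ.le.trans hd
      have := TransmissionLine.nu_nonneg L C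
      have := TransmissionLine.theta_nonneg L C R G
      positivity
    calc _ ≤ K := hY s (h s hs).1 (h s hs).2 d hd
      _ ≤ _ := le_mul_of_one_le_right hK.le h1
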